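/- **Theorem.** Let $\mathbf Q$ be the class of functions $q\in C^2([0,1])$ with $q:[0,1]\to[0,1]$ and $|q^{(i)}(x)|\le 1$ for all $x\in[0,1]$, $i=0,1,2$. For $q\in\mathbf Q$ let $\lambda(q)$ be the smallest eigenvalue of the Sturm–Liouville problem $$u''(x)-q(x)u(x)+\lambda u(x)=0\quad (0<x<1),\qquad u(0)=u(1)=0,\quad u\not\equiv 0.$$ A bit query, with $m'$ index qubits, $m''$ value qubits and $w$ ancilla qubits, is given by functions $\tau:\{0,1\}^{m'}\to[0,1]$ and $\beta:[0,1]\to\{0,1\}^{m''}$; for $q\in\mathbf Q$ it is the unitary operator on $(\mathbb C^2)^{\otimes(m'+m''+w)}$ with $$Q_q\,|j\rangle|k\rangle|y\rangle=|j\rangle\,|k\oplus\beta(q(\tau(j)))\rangle\,|y\rangle ,$$ where $\oplus$ is bitwise addition modulo $2$. A quantum algorithm with $T$ bit queries consists of such $m',m'',w,\tau,\beta$, a unit vector $\psi_0$, unitary matrices $U_0,\dots,U_T$, a projective measurement with finitely many outcomes $j$, and a real number $\phi(j)$ for each outcome, all independent of $q$. On input $q$ it measures the state $U_TQ_qU_{T-1}Q_q\cdots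 U_1Q_qU_0\psi_0$ and outputs $\phi(j)$ when the outcome is $j$. It computes an $\varepsilon$-approximation with probability $\tfrac34$ if, for every $q\in\mathbf Q$, the probability that $|\lambda(q)-\phi(j)|\le\varepsilon$ is at least $\tfrac34$. Let $n^{\text{bit-query}}(\varepsilon)$ be the minimal $T$ for which an algorithm with $T$ bit queries computes an $\varepsilon$-approximation with probability $\tfrac34$ ($\infty$ if there is none). Then $n^{\text{bit-query}}(\varepsilon)=\Omega(\varepsilon^{-1/3})$ as $\varepsilon\to0$: there are constants $c>0$ and $\varepsilon_0>0$ such that $$n^{\text{bit-query}}(\varepsilon)\ \ge\ c\,\varepsilon^{-1/3}\qquad\text{for all }\varepsilon\in(0,\varepsilon_0].$$ -/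

import Mathlib

open scoped ENNReal

noncomputable section

namespace SturmLiouville

/-- The class of potentials: `q : [0,1] → [0,1]`, `q ∈ C²([0,1])`, with `q`, `q'`, `q''` all
bounded by `1` in absolute value on `[0,1]`. A potential is represented by a function on `ℝ`
of which only the values on `[0,1]` matter. -/
def potentialClass : Set (ℝ → ℝ) :=
  {q | ContDiffOn ℝ 2 q (Set.Icc 0 1) ∧
    (∀ x ∈ Set.Icc (0 : ℝ) 1, q x ∈ Set.Icc (0 : ℝ) 1) ∧
    ∀ i : ℕ, i ≤ 2 → ∀ x ∈ Set.Icc (0 : ℝ) 1,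
      |iteratedDerivWithin i q (Set.Icc 0 1) x| ≤ 1}

/-- `l` is an eigenvalue of `u'' - q u + l u = 0` on `(0,1)` with `u(0) = u(1) = 0`. -/
def IsEigenvalue (q : ℝ → ℝ) (l : ℝ) : Prop :=
  ∃ u : ℝ → ℝ, ContDiffOn ℝ 2 u (Set.Icc 0 1) ∧
    (∃ x ∈ Set.Icc (0 : ℝ) 1, u x ≠ 0) ∧
    u 0 = 0 ∧ u 1 = 0 ∧
    ∀ x ∈ Set.Ioo (0 : ℝ) 1, iteratedDeriv 2 u x - q x * u x + l * u x = 0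

/-- The smallest eigenvalue. (For a continuous potential the set of eigenvalues is non-empty and
has a least element, so the infimum is this least element.) -/
def smallestEigenvalue (q : ℝ → ℝ) : ℝ :=
  sInf {l | IsEigenvalue q l}

/-- Labels of the computational basis of `m` qubits: bit strings of length `m`. The addition is
bitwise addition modulo `2`. -/
abbrev Bits (m : ℕ) : Type := Fin m → ZMod 2

/-- The data of a bit query: the index register has `mIndex` qubits, the value register has
`mValue` qubits, and there are `mAncilla` ancilla qubits on which the query acts trivially. -/
structure BitQuery where
  mIndex : ℕ
  mValue : ℕ
  mAncilla : ℕ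
  /-- the sample points -/
  τ : Bits mIndex → unitInterval
  /-- the encoding of function values by bits; only its values on `[0,1]` matter -/
  β : ℝ → Bits mValue

/-- Labels `(j, k, y)` of the computational basis of all the qubits. -/
abbrev BitQuery.Label (Q : BitQuery) : Type :=
  Bits Q.mIndex × Bits Q.mValue × Bits Q.mAncilla

/-- The action of the query on labels: `(j, k, y) ↦ (j, k ⊕ β(q(τ(j))), y)`. -/
def BitQuery.act (Q : BitQuery) (q : ℝ → ℝ) (b : Q.Label) : Q.Label :=
  (b.1, b.2.1 + Q.β (q (Q.τ b.1)), b.2.2)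

/-- The query operator `|j⟩|k⟩|y⟩ ↦ |j⟩|k ⊕ β(q(τ(j)))⟩|y⟩` as a matrix. -/
def BitQuery.matrix (Q : BitQuery) (q : ℝ → ℝ) : Matrix Q.Label Q.Label ℂ :=
  Matrix.of fun a b => if a = Q.act q b then 1 else 0

/-- A projective measurement with finitely many outcomes. (Hermitian idempotents with sum `1`
are automatically mutually orthogonal.) -/
structure ProjectiveMeasurement (ι : Type) [Fintype ι] [DecidableEq ι] where
  M : ℕ
  P : Fin M → Matrix ι ι ℂ
  isHermitian : ∀ j, (P j).IsHermitian
  idempotent : ∀ j, P j * P j = P j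
  sum_eq_one : ∑ j, P j = 1

/-- A quantum algorithm using `T` bit queries. None of its data depends on the potential; the
potential enters through the query operator only. -/
structure BitQueryAlgorithm where
  query : BitQuery
  /-- the number of queries -/
  T : ℕ
  /-- the unitary matrices; only `U 0, …, U T` are used -/
  U : ℕ → Matrix.unitaryGroup query.Label ℂ
  /-- the initial state -/
  ψ₀ : query.Label → ℂ
  ψ₀_unit : ∑ b, ‖ψ₀ b‖ ^ 2 = 1
  /-- the final measurement -/
  meas : ProjectiveMeasurement query.Label
  /-- the number computed classically from the outcome of the measurement -/
  output : Fin meas.M → ℝ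

namespace BitQueryAlgorithm

/-- The state `U_t Q_q U_{t-1} Q_q ⋯ U_1 Q_q U_0 ψ₀`. -/
def state (A : BitQueryAlgorithm) (q : ℝ → ℝ) : ℕ → A.query.Label → ℂ
  | 0 => (A.U 0 : Matrix A.query.Label A.query.Label ℂ).mulVec A.ψ₀
  | t + 1 => (A.U (t + 1) : Matrix A.query.Label A.query.Label ℂ).mulVec
      ((A.query.matrix q).mulVec (A.state q t))

/-- The probability of the outcome `j` when the final state is measured. -/
def prob (A : BitQueryAlgorithm) (q : ℝ → ℝ) (j : Fin A.meas.M) : ℝ :=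
  ∑ b, ‖((A.meas.P j).mulVec (A.state q A.T)) b‖ ^ 2

/-- For every potential of the class, the algorithm outputs an `ε`-approximation of the smallest
eigenvalue with probability at least `3/4`. -/
def ComputesApproximation (A : BitQueryAlgorithm) (ε : ℝ) : Prop :=
  ∀ q ∈ potentialClass,
    3 / 4 ≤ ∑ j with |smallestEigenvalue q - A.output j| ≤ ε, A.prob q j

end BitQueryAlgorithm

/-- The bit-query complexity: the minimal number of bit queries of an algorithm that computes an
`ε`-approximation with probability `3/4` (`∞` if there were no such algorithm). -/
def bitQueryComplexity (ε : ℝ) : ℕ∞ :=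
  sInf {n : ℕ∞ | ∃ A : BitQueryAlgorithm, A.ComputesApproximation ε ∧ n = (A.T : ℕ∞)}

end SturmLiouville

end

/-! The bounds on `q`, `q'` and `q''` allow `n` disjoint bumps of width `1/(2n)` and height of order
`n⁻²` inside `[1/4, 3/4]`. Switching bumps on and off gives `2 ^ n` potentials, indexed by a
hypercube. Toggling one bump changes the integral of the potential, and hence the smallest
eigenvalue, by at least a constant times `n⁻³`. With `n` of order `ε^(-1/3)`, an `ε`-approximation
distinguishes any two neighbouring vertices.

The quantum part (`le_T_of_hypercube`) sums the squared distances of the states over all edges. The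
sum starts at `0` and must reach order `n * 2 ^ n`. A query separates neighbours only through the
mass of the two states on the cell of the flipped bit. The cells are disjoint, so these masses add
up to at most `1` at each vertex, and one query adds at most `4 * 2 ^ n`. Hence `T` is at least of
order `n`.

The spectral part (`integral_le_smallestEigenvalue_sub`) takes positive solutions `u`, `v` for
potentials `p ≤ q` with eigenvalues `l`, `k`. Integrating the derivative of their Wronskian gives
`(k - l) ∫ uv = ∫ (q - p) uv`. Both solutions are concave, so `uv` is comparable to its maximum on
the middle half, where `q - p` lives. The solutions come from a Prüfer angle, and a Sturm comparison
shows that their eigenvalues are the smallest. -/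

namespace SturmLiouville

/-! ### Quantum lower bound on the hypercube. -/

section Quantum

open Matrix

/-- The squared Euclidean norm of `A v` is the value at `v` of the quadratic form of `Aᴴ A`. -/
lemma sum_norm_sq_mulVec {ι : Type*} [Fintype ι] (A : Matrix ι ι ℂ) (v : ι → ℂ) :
    ((∑ b, ‖(A *ᵥ v) b‖ ^ 2 : ℝ) : ℂ) = star v ⬝ᵥ ((Aᴴ * A) *ᵥ v) := by
  rw [← Matrix.mulVec_mulVec, Matrix.dotProduct_mulVec, ← Matrix.star_mulVec, dotProduct]
  push_cast
  refine Finset.sum_congr rfl fun b _ => ?_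
  rw [Pi.star_apply, Complex.star_def, Complex.conj_mul']

lemma sum_norm_sq_unitary_mulVec {ι : Type*} [Fintype ι] [DecidableEq ι]
    (U : Matrix.unitaryGroup ι ℂ) (v : ι → ℂ) :
    ∑ b, ‖((U : Matrix ι ι ℂ) *ᵥ v) b‖ ^ 2 = ∑ b, ‖v b‖ ^ 2 := by
  have h1 := sum_norm_sq_mulVec (U : Matrix ι ι ℂ) v
  have h2 := sum_norm_sq_mulVec (1 : Matrix ι ι ℂ) v
  have hU : (U : Matrix ι ι ℂ)ᴴ * (U : Matrix ι ι ℂ) = 1 :=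
    Matrix.mem_unitaryGroup_iff'.1 U.2
  rw [hU] at h1
  simp only [Matrix.conjTranspose_one, Matrix.mul_one, Matrix.one_mulVec] at h1 h2
  exact_mod_cast h1.trans h2.symm

lemma ProjectiveMeasurement.sum_norm_sq {ι : Type} [Fintype ι] [DecidableEq ι]
    (m : ProjectiveMeasurement ι) (v : ι → ℂ) :
    ∑ j, ∑ b, ‖(m.P j *ᵥ v) b‖ ^ 2 = ∑ b, ‖v b‖ ^ 2 := by
  have h2 := sum_norm_sq_mulVec (1 : Matrix ι ι ℂ) v
  simp only [Matrix.conjTranspose_one, Matrix.mul_one, Matrix.one_mulVec] at h2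
  have h1 : ((∑ j, ∑ b, ‖(m.P j *ᵥ v) b‖ ^ 2 : ℝ) : ℂ) = star v ⬝ᵥ v := by
    rw [Complex.ofReal_sum]
    simp_rw [sum_norm_sq_mulVec, fun j => (m.isHermitian j).eq, m.idempotent]
    rw [← dotProduct_sum, ← Matrix.sum_mulVec, m.sum_eq_one, Matrix.one_mulVec]
  exact_mod_cast h1.trans h2.symm

lemma BitQuery.act_act (Q : BitQuery) (q : ℝ → ℝ) (b : Q.Label) : Q.act q (Q.act q b) = b := by
  obtain ⟨j, k, y⟩ := b
  simp only [BitQuery.act, Prod.mk.injEq, true_and, and_true]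
  funext i
  simp only [Pi.add_apply]
  rw [add_assoc, CharTwo.add_self_eq_zero, add_zero]

lemma BitQuery.act_involutive (Q : BitQuery) (q : ℝ → ℝ) : Function.Involutive (Q.act q) :=
  Q.act_act q

lemma BitQuery.matrix_mulVec (Q : BitQuery) (q : ℝ → ℝ) (v : Q.Label → ℂ) (b : Q.Label) :
    (Q.matrix q *ᵥ v) b = v (Q.act q b) := by
  rw [Matrix.mulVec, dotProduct, Finset.sum_eq_single (Q.act q b)]
  · simp [BitQuery.matrix, Q.act_act]
  · intro c _ hc
    have : b ≠ Q.act q c := fun h => hc (by rw [h, Q.act_act])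
    simp [BitQuery.matrix, this]
  · simp

lemma BitQueryAlgorithm.sum_norm_sq_state (A : BitQueryAlgorithm) (q : ℝ → ℝ) (t : ℕ) :
    ∑ b, ‖A.state q t b‖ ^ 2 = 1 := by
  induction t with
  | zero => rw [BitQueryAlgorithm.state, sum_norm_sq_unitary_mulVec, A.ψ₀_unit]
  | succ t ih =>
    rw [BitQueryAlgorithm.state, sum_norm_sq_unitary_mulVec, ← ih]
    simp_rw [BitQuery.matrix_mulVec]
    exact (A.query.act_involutive q).bijective.sum_comp fun b => ‖A.state q t b‖ ^ 2

lemma norm_sub_sq_le_two_mul (a b : ℂ) : ‖a - b‖ ^ 2 ≤ 2 * (‖a‖ ^ 2 + ‖b‖ ^ 2) := by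
  have h := norm_sub_le a b
  nlinarith [sq_nonneg (‖a‖ - ‖b‖), norm_nonneg (a - b), norm_nonneg a, norm_nonneg b]

open Classical in
/-- One query to two potentials that agree outside a set `I` increases the squared distance
of two states by at most twice their total mass on the labels whose sample point is in `I`. -/
lemma BitQuery.sum_norm_sub_sq_le (Q : BitQuery) {p q : ℝ → ℝ} {I : Set ℝ}
    (h : ∀ t, t ∉ I → p t = q t) (v w : Q.Label → ℂ) :
    ∑ b, ‖(Q.matrix p *ᵥ v) b - (Q.matrix q *ᵥ w) b‖ ^ 2 ≤ ∑ b, ‖v b - w b‖ ^ 2 +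
      2 * (∑ b : Q.Label, (if (Q.τ b.1 : ℝ) ∈ I then ‖v b‖ ^ 2 else 0) +
        ∑ b : Q.Label, (if (Q.τ b.1 : ℝ) ∈ I then ‖w b‖ ^ 2 else 0)) := by
  -- The query permutes labels and fixes the index register, so all three sums can be reindexed and
  -- the inequality becomes pointwise. The mass of `w` is reindexed by `Q.act q`, to match the query
  -- applied to `w`.
  have e1 := (Q.act_involutive p).bijective.sum_comp fun b => ‖v b - w b‖ ^ 2
  have e2 := (Q.act_involutive p).bijective.sum_comp
    fun b : Q.Label => if (Q.τ b.1 : ℝ) ∈ I then ‖v b‖ ^ 2 else 0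
  have e3 := (Q.act_involutive q).bijective.sum_comp
    fun b : Q.Label => if (Q.τ b.1 : ℝ) ∈ I then ‖w b‖ ^ 2 else 0
  rw [← e1, ← e2, ← e3, ← Finset.sum_add_distrib, Finset.mul_sum, ← Finset.sum_add_distrib]
  refine Finset.sum_le_sum fun b _ => ?_
  rw [Q.matrix_mulVec, Q.matrix_mulVec]
  have hp : (Q.act p b).1 = b.1 := rfl
  have hq : (Q.act q b).1 = b.1 := rfl
  rw [hp, hq]
  by_cases hb : (Q.τ b.1 : ℝ) ∈ I
  · simp only [hb, if_true]
    have := norm_sub_sq_le_two_mul (v (Q.act p b)) (w (Q.act q b))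
    nlinarith [sq_nonneg ‖v (Q.act p b) - w (Q.act p b)‖]
  · have : Q.act p b = Q.act q b := by simp only [BitQuery.act, h _ hb]
    simp [hb, this]

/-- The total squared distance between the states belonging to neighbouring vertices of the
hypercube grows at most linearly in the number of queries. -/
lemma BitQueryAlgorithm.sum_hypercube_edges_le (A : BitQueryAlgorithm) {n : ℕ}
    (q : (Fin n → ZMod 2) → ℝ → ℝ) (I : Fin n → Set ℝ)
    (hI : Pairwise fun i j => Disjoint (I i) (I j))
    (hq : ∀ x i t, t ∉ I i → q x t = q (x + Pi.single i 1) t) (t : ℕ) :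
    ∑ x, ∑ i, ∑ b, ‖A.state (q x) t b - A.state (q (x + Pi.single i 1)) t b‖ ^ 2 ≤
      4 * t * 2 ^ n := by
  classical
  induction t with
  | zero => simp [BitQueryAlgorithm.state]
  | succ t ih =>
    let m : (Fin n → ZMod 2) → Fin n → ℝ := fun x i =>
      ∑ b : A.query.Label, if (A.query.τ b.1 : ℝ) ∈ I i then ‖A.state (q x) t b‖ ^ 2 else 0
    have step : ∀ x i,
        ∑ b, ‖A.state (q x) (t + 1) b - A.state (q (x + Pi.single i 1)) (t + 1) b‖ ^ 2 ≤
        ∑ b, ‖A.state (q x) t b - A.state (q (x + Pi.single i 1)) t b‖ ^ 2 +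
          2 * (m x i + m (x + Pi.single i 1) i) := by
      intro x i
      refine le_of_eq_of_le ?_ (A.query.sum_norm_sub_sq_le (hq x i) _ _)
      have hU := sum_norm_sq_unitary_mulVec (A.U (t + 1))
        (A.query.matrix (q x) *ᵥ A.state (q x) t -
          A.query.matrix (q (x + Pi.single i 1)) *ᵥ A.state (q (x + Pi.single i 1)) t)
      rw [Matrix.mulVec_sub] at hU
      exact hU
    -- Disjointness: each label is counted for at most one `i`.
    have hm : ∀ x, ∑ i, m x i ≤ 1 := by
      intro x
      rw [Finset.sum_comm, ← A.sum_norm_sq_state (q x) t]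
      refine Finset.sum_le_sum fun b _ => ?_
      by_cases hb : ∃ i, (A.query.τ b.1 : ℝ) ∈ I i
      · obtain ⟨i, hi⟩ := hb
        rw [Finset.sum_eq_single i]
        · simp [hi]
        · intro j _ hj
          rw [if_neg]
          exact fun h => Set.disjoint_left.1 (hI hj) h hi
        · simp
      · push Not at hb
        simp [hb]
    -- Flipping bit `i` permutes the vertices, so the masses at the neighbours have the same total.
    have hshift : ∑ x : Fin n → ZMod 2, ∑ i, m (x + Pi.single i 1) i = ∑ x, ∑ i, m x i := by
      rw [Finset.sum_comm]
      conv_rhs => rw [Finset.sum_comm]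
      exact Finset.sum_congr rfl fun i _ =>
        Equiv.sum_comp (Equiv.addRight (Pi.single i 1 : Fin n → ZMod 2)) fun x => m x i
    have htot : ∑ x, ∑ i, m x i ≤ 2 ^ n := by
      refine (Finset.sum_le_sum fun x _ => hm x).trans ?_
      simp
    calc _ ≤ ∑ x, ∑ i, (∑ b, ‖A.state (q x) t b - A.state (q (x + Pi.single i 1)) t b‖ ^ 2 +
          2 * (m x i + m (x + Pi.single i 1) i)) :=
          Finset.sum_le_sum fun x _ => Finset.sum_le_sum fun i _ => step x i
      _ ≤ _ := by
          simp only [Finset.sum_add_distrib, ← Finset.mul_sum]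
          rw [hshift]
          push_cast
          linarith

/-- An algorithm that computes `ε`-approximations must reach final states at squared distance at
least `1/8` on two potentials whose smallest eigenvalues differ by more than `2 ε`. -/
lemma BitQueryAlgorithm.le_sum_norm_sub_sq (A : BitQueryAlgorithm) {ε : ℝ}
    (hA : A.ComputesApproximation ε) {p q : ℝ → ℝ} (hp : p ∈ potentialClass)
    (hq : q ∈ potentialClass) (h : 2 * ε < |smallestEigenvalue p - smallestEigenvalue q|) :
    1 / 8 ≤ ∑ b, ‖A.state p A.T b - A.state q A.T b‖ ^ 2 := by
  classical
  set G := Finset.univ.filter fun j => |smallestEigenvalue p - A.output j| ≤ ε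
  set H := Finset.univ.filter fun j => |smallestEigenvalue q - A.output j| ≤ ε
  have hG : 3 / 4 ≤ ∑ j ∈ G, A.prob p j := hA p hp
  have hH : 3 / 4 ≤ ∑ j ∈ H, A.prob q j := hA q hq
  have hdisj : Disjoint G H := by
    rw [Finset.disjoint_left]
    intro j hj hj'
    rw [Finset.mem_filter] at hj hj'
    have h1 := abs_sub_le (smallestEigenvalue p) (A.output j) (smallestEigenvalue q)
    rw [abs_sub_comm (A.output j)] at h1
    linarith [hj.2, hj'.2]
  have hnn : ∀ j, 0 ≤ A.prob q j := fun j => Finset.sum_nonneg fun b _ => sq_nonneg _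
  have htot : ∑ j, A.prob q j = 1 := by
    simp only [BitQueryAlgorithm.prob]
    rw [A.meas.sum_norm_sq, A.sum_norm_sq_state]
  have hGq : ∑ j ∈ G, A.prob q j ≤ 1 / 4 := by
    have h1 : ∑ j ∈ G ∪ H, A.prob q j ≤ 1 := by
      rw [← htot]
      exact Finset.sum_le_sum_of_subset_of_nonneg (Finset.subset_univ _) fun j _ _ => hnn j
    rw [Finset.sum_union hdisj] at h1
    linarith
  have hd := A.meas.sum_norm_sq (A.state p A.T - A.state q A.T)
  simp only [Pi.sub_apply] at hd
  rw [← hd]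
  have hsub : ∑ j ∈ G, ∑ b, ‖(A.meas.P j *ᵥ (A.state p A.T - A.state q A.T)) b‖ ^ 2 ≤
      ∑ j, ∑ b, ‖(A.meas.P j *ᵥ (A.state p A.T - A.state q A.T)) b‖ ^ 2 :=
    Finset.sum_le_sum_of_subset_of_nonneg (Finset.subset_univ _) fun j _ _ =>
      Finset.sum_nonneg fun b _ => sq_nonneg _
  -- From `‖a‖² ≤ 2 (‖a - b‖² + ‖b‖²)`. With `d` the squared distance this yields `3/4 ≤ 2 (d +
  -- 1/4)`, hence `d ≥ 1/8`.
  have hpt : ∑ j ∈ G, A.prob p j ≤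
      ∑ j ∈ G, 2 * (∑ b, ‖(A.meas.P j *ᵥ (A.state p A.T - A.state q A.T)) b‖ ^ 2 +
        A.prob q j) := by
    refine Finset.sum_le_sum fun j _ => ?_
    simp only [BitQueryAlgorithm.prob]
    rw [← Finset.sum_add_distrib, Finset.mul_sum]
    refine Finset.sum_le_sum fun b _ => ?_
    rw [Matrix.mulVec_sub, Pi.sub_apply]
    have := norm_sub_sq_le_two_mul ((A.meas.P j *ᵥ A.state p A.T) b -
      (A.meas.P j *ᵥ A.state q A.T) b) (-(A.meas.P j *ᵥ A.state q A.T) b)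
    simpa using this
  rw [← Finset.mul_sum, Finset.sum_add_distrib] at hpt
  linarith

/-- The hypercube lower bound: if flipping one of `n` bits changes a potential of the class only
on the set belonging to this bit, these sets being disjoint, and moves the smallest eigenvalue by
more than `2 ε`, then computing an `ε`-approximation takes at least `n / 32` queries. -/
lemma BitQueryAlgorithm.le_T_of_hypercube (A : BitQueryAlgorithm) {ε : ℝ}
    (hA : A.ComputesApproximation ε) {n : ℕ}
    (q : (Fin n → ZMod 2) → ℝ → ℝ) (I : Fin n → Set ℝ)
    (hI : Pairwise fun i j => Disjoint (I i) (I j))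
    (hq : ∀ x i t, t ∉ I i → q x t = q (x + Pi.single i 1) t)
    (hmem : ∀ x, q x ∈ potentialClass)
    (hgap : ∀ x i,
      2 * ε < |smallestEigenvalue (q x) - smallestEigenvalue (q (x + Pi.single i 1))|) :
    (n : ℝ) / 32 ≤ A.T := by
  have h1 := A.sum_hypercube_edges_le q I hI hq A.T
  have h2 : ∑ _x : Fin n → ZMod 2, ∑ _i : Fin n, (1 / 8 : ℝ) ≤
      ∑ x, ∑ i, ∑ b, ‖A.state (q x) A.T b - A.state (q (x + Pi.single i 1)) A.T b‖ ^ 2 :=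
    Finset.sum_le_sum fun x _ => Finset.sum_le_sum fun i _ =>
      A.le_sum_norm_sub_sq hA (hmem x) (hmem _) (hgap x i)
  have h3 : ∑ _x : Fin n → ZMod 2, ∑ _i : Fin n, (1 / 8 : ℝ) = 2 ^ n * (n * (1 / 8)) := by
    simp
  rw [h3] at h2
  have h4 := h2.trans h1
  have h5 : (2 : ℝ) ^ n * (n * (1 / 8)) ≤ 2 ^ n * (4 * A.T) := by linarith
  have := le_of_mul_le_mul_left h5 (by positivity)
  linarith

end Quantum

/-! ### Positive Dirichlet solutions from the Prüfer angle. -/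

section GroundState

open Set Real MeasureTheory

lemma abs_sin_sq_sub_sin_sq_le (a b : ℝ) : |sin a ^ 2 - sin b ^ 2| ≤ |a - b| := by
  have h : sin a ^ 2 - sin b ^ 2 = sin (a + b) * sin (a - b) := by
    rw [sin_add, sin_sub]
    linear_combination sin b ^ 2 * sin_sq_add_cos_sq a - sin a ^ 2 * sin_sq_add_cos_sq b
  rw [h, abs_mul]
  exact (mul_le_mul (abs_sin_le_one _) abs_sin_le_abs (abs_nonneg _) zero_le_one).trans_eq
    (one_mul _)

/-- The vector field of the Prüfer angle of `u'' - q u + (π² + μ) u = 0`. -/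
noncomputable def pruferField (q : ℝ → ℝ) (μ t θ : ℝ) : ℝ := π + (μ - q t) / π * sin θ ^ 2

lemma abs_sub_div_pi_le {a b : ℝ} (ha : a ∈ Icc (0 : ℝ) 1) (hb : b ∈ Icc (0 : ℝ) 1) :
    |(a - b) / π| ≤ 1 := by
  rw [abs_div, abs_of_pos pi_pos, div_le_one pi_pos]
  have : |a - b| ≤ 1 := abs_le.2 ⟨by linarith [ha.1, hb.2], by linarith [ha.2, hb.1]⟩
  linarith [pi_gt_three]

lemma pruferField_lipschitz {q : ℝ → ℝ} (hq : ∀ t, q t ∈ Icc (0 : ℝ) 1) {μ : ℝ}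
    (hμ : μ ∈ Icc (0 : ℝ) 1) (t : ℝ) : LipschitzWith 1 (pruferField q μ t) := by
  refine LipschitzWith.of_dist_le_mul fun a b => ?_
  rw [Real.dist_eq, Real.dist_eq, pruferField, pruferField, add_sub_add_left_eq_sub, ← mul_sub,
    abs_mul, NNReal.coe_one]
  exact mul_le_mul (abs_sub_div_pi_le hμ (hq t)) (abs_sin_sq_sub_sin_sq_le a b) (abs_nonneg _)
    zero_le_one

lemma abs_pruferField_sub_pi_le {q : ℝ → ℝ} (hq : ∀ t, q t ∈ Icc (0 : ℝ) 1) {μ : ℝ}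
    (hμ : μ ∈ Icc (0 : ℝ) 1) (t θ : ℝ) : |pruferField q μ t θ - π| ≤ 1 := by
  rw [pruferField, add_sub_cancel_left, abs_mul, abs_of_nonneg (sq_nonneg (sin θ))]
  have := abs_sub_div_pi_le hμ (hq t)
  have := sin_sq_le_one θ
  nlinarith [abs_nonneg ((μ - q t) / π), sq_nonneg (sin θ)]

lemma exists_pruferAngle {q : ℝ → ℝ} (hqc : Continuous q) (hq : ∀ t, q t ∈ Icc (0 : ℝ) 1) {μ : ℝ}
    (hμ : μ ∈ Icc (0 : ℝ) 1) :
    ∃ θ : ℝ → ℝ, Continuous θ ∧ θ 0 = 0 ∧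
      ∀ t ∈ Ioo (-1 : ℝ) 2, HasDerivAt θ (pruferField q μ t (θ t)) t := by
  have h0 : (0 : ℝ) ∈ Icc (-1 : ℝ) 2 := by norm_num
  -- The field is bounded by `π + 1 ≤ 5` and times differ from `0` by at most `2`, whence the radius
  -- `10`. The interval exceeds `[0,1]` to give two-sided derivatives at `0` and `1`.
  have hPL : IsPicardLindelof (pruferField q μ) (⟨0, h0⟩ : Icc (-1 : ℝ) 2) (0 : ℝ) 10 0 5 1 := by
    refine ⟨fun t _ => (pruferField_lipschitz hq hμ t).lipschitzOnWith, fun x _ => ?_,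
      fun t _ x _ => ?_, by norm_num⟩
    · unfold pruferField
      fun_prop
    · have h := abs_le.1 (abs_pruferField_sub_pi_le hq hμ t x)
      rw [Real.norm_eq_abs, abs_le]
      constructor <;> norm_num <;> linarith [pi_gt_three, pi_lt_four]
  obtain ⟨α, hα0, hα⟩ := hPL.exists_eq_forall_mem_Icc_hasDerivWithinAt₀
  have hle : (-1 : ℝ) ≤ 2 := by norm_num
  have hext : ∀ t ∈ Icc (-1 : ℝ) 2, IccExtend hle ((Icc (-1 : ℝ) 2).domRestrict α) t = α t :=
    fun t ht => by rw [IccExtend_of_mem _ _ ht, domRestrict_apply]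
  refine ⟨IccExtend hle ((Icc (-1 : ℝ) 2).domRestrict α), ?_, by rw [hext 0 h0]; exact hα0,
    fun t ht => ?_⟩
  · exact (continuousOn_iff_continuous_domRestrict.1
      fun t ht => (hα t ht).continuousWithinAt).Icc_extend'
  · have ht' := Ioo_subset_Icc_self ht
    rw [hext t ht']
    refine ((hα t ht').hasDerivAt (Icc_mem_nhds ht.1 ht.2)).congr_of_eventuallyEq ?_
    filter_upwards [Icc_mem_nhds ht.1 ht.2] with s hs using hext s hs

/-- A Prüfer angle running from `0` to `π` exists for a suitable spectral parameter. -/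
lemma exists_pruferAngle_eq_pi {q : ℝ → ℝ} (hqc : Continuous q)
    (hq : ∀ t, q t ∈ Icc (0 : ℝ) 1) :
    ∃ μ ∈ Icc (0 : ℝ) 1, ∃ θ : ℝ → ℝ, Continuous θ ∧ θ 0 = 0 ∧ θ 1 = π ∧
      ∀ t ∈ Ioo (-1 : ℝ) 2, HasDerivAt θ (pruferField q μ t (θ t)) t := by
  choose! Θ hΘc hΘ0 hΘ using fun μ (hμ : μ ∈ Icc (0 : ℝ) 1) => exists_pruferAngle hqc hq hμ
  have hsub : ∀ t ∈ Icc (0 : ℝ) 1, t ∈ Ioo (-1 : ℝ) 2 := fun t ht =>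
    ⟨by linarith [ht.1], by linarith [ht.2]⟩
  -- Grönwall: the fields for `μ` and `ν` differ by at most `|μ - ν|`, so the final angle is
  -- Lipschitz in `μ`.
  have hcont : ContinuousOn (fun μ => Θ μ 1) (Icc 0 1) := by
    refine (LipschitzOnWith.of_dist_le_mul (K := ⟨exp 1 - 1, by linarith [add_one_le_exp (1 : ℝ)]⟩)
      fun μ hμ ν hν => ?_).continuousOn
    have h := dist_le_of_approx_trajectories_ODE (v := pruferField q μ) (K := 1) (a := 0) (b := 1)
      (f := Θ μ) (g := Θ ν) (f' := fun t => pruferField q μ t (Θ μ t))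
      (g' := fun t => pruferField q ν t (Θ ν t)) (εf := 0) (εg := dist μ ν) (δ := 0)
      (pruferField_lipschitz hq hμ) (hΘc μ hμ).continuousOn
      (fun t ht => (hΘ μ hμ t (hsub t (Ico_subset_Icc_self ht))).hasDerivWithinAt)
      (fun t ht => by simp) (hΘc ν hν).continuousOn
      (fun t ht => (hΘ ν hν t (hsub t (Ico_subset_Icc_self ht))).hasDerivWithinAt)
      (fun t ht => by
        rw [pruferField, pruferField, Real.dist_eq, dist_comm, Real.dist_eq]
        rw [add_sub_add_left_eq_sub, ← sub_mul, ← sub_div, sub_sub_sub_cancel_right, abs_mul,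
          abs_div, abs_of_pos pi_pos, abs_of_nonneg (sq_nonneg (sin (Θ ν t)))]
        calc |ν - μ| / π * sin (Θ ν t) ^ 2 ≤ |ν - μ| / π * 1 := by
              gcongr
              exact sin_sq_le_one _
          _ ≤ |ν - μ| := by
              rw [mul_one]
              exact div_le_self (abs_nonneg _) (by linarith [pi_gt_three]))
      (by rw [hΘ0 μ hμ, hΘ0 ν hν, dist_self]) 1 (by norm_num)
    rw [NNReal.coe_one, gronwallBound_of_K_ne_0 one_ne_zero] at h
    simp only [zero_mul, zero_add, div_one, sub_zero, mul_one] at h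
    rw [mul_comm]
    exact h
  have hdiff : ∀ μ ∈ Icc (0 : ℝ) 1, ∀ t ∈ interior (Icc (0 : ℝ) 1),
      HasDerivAt (Θ μ) (pruferField q μ t (Θ μ t)) t := fun μ hμ t ht =>
    hΘ μ hμ t (hsub t (interior_subset ht))
  have m0 : (0 : ℝ) ∈ Icc (0 : ℝ) 1 := by norm_num
  have m1 : (1 : ℝ) ∈ Icc (0 : ℝ) 1 := by norm_num
  -- Since `0 ≤ q ≤ 1`, the angular speed is at most `π` for `μ = 0` and at least `π` for `μ = 1`.
  have hlow : Θ 0 1 ≤ π := by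
    have := (convex_Icc (0 : ℝ) 1).image_sub_le_mul_sub_of_deriv_le (hΘc 0 m0).continuousOn
      (fun t ht => (hdiff 0 m0 t ht).differentiableAt.differentiableWithinAt) (C := π)
      (fun t ht => by
        rw [(hdiff 0 m0 t ht).deriv, pruferField]
        have : (0 - q t) / π ≤ 0 := div_nonpos_of_nonpos_of_nonneg (by linarith [(hq t).1]) pi_pos.le
        nlinarith [sq_nonneg (sin (Θ 0 t))]) 0 m0 1 m1 zero_le_one
    rw [hΘ0 0 m0] at this
    linarith
  have hhigh : π ≤ Θ 1 1 := by
    have := (convex_Icc (0 : ℝ) 1).mul_sub_le_image_sub_of_le_deriv (hΘc 1 m1).continuousOn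
      (fun t ht => (hdiff 1 m1 t ht).differentiableAt.differentiableWithinAt) (C := π)
      (fun t ht => by
        rw [(hdiff 1 m1 t ht).deriv, pruferField]
        have : 0 ≤ (1 - q t) / π := div_nonneg (by linarith [(hq t).2]) pi_pos.le
        nlinarith [sq_nonneg (sin (Θ 1 t))]) 0 m0 1 m1 zero_le_one
    rw [hΘ0 1 m1] at this
    linarith
  obtain ⟨μ, hμ, h⟩ := intermediate_value_Icc zero_le_one hcont ⟨hlow, hhigh⟩
  exact ⟨μ, hμ, Θ μ, hΘc μ hμ, hΘ0 μ hμ, h, hΘ μ hμ⟩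

/-- `u` is a solution of `u'' - q u + l u = 0` with derivative `u'`, positive on `(0,1)` and
vanishing at `0` and `1`. -/
structure IsGroundState (q : ℝ → ℝ) (l : ℝ) (u u' : ℝ → ℝ) : Prop where
  one_lt : 1 < l
  hasDerivAt : ∀ t ∈ Ioo (-1 : ℝ) 2, HasDerivAt u (u' t) t
  hasDerivAt' : ∀ t ∈ Ioo (-1 : ℝ) 2, HasDerivAt u' ((q t - l) * u t) t
  zero : u 0 = 0
  one : u 1 = 0
  pos : ∀ t ∈ Ioo (0 : ℝ) 1, 0 < u t

lemma exists_isGroundState {q : ℝ → ℝ} (hqc : Continuous q) (hq : ∀ t, q t ∈ Icc (0 : ℝ) 1) :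
    ∃ l u u', IsGroundState q l u u' := by
  obtain ⟨μ, hμ, θ, hθc, hθ0, hθ1, hθ⟩ := exists_pruferAngle_eq_pi hqc hq
  -- Logarithmic derivative of the Prüfer radius `r`, chosen so that `r sin θ` has derivative `π r
  -- cos θ`.
  set ρ : ℝ → ℝ := fun t => -((μ - q t) / π) * (sin (θ t) * cos (θ t)) with hρ
  have hρc : Continuous ρ := by fun_prop
  set r : ℝ → ℝ := fun t => exp (∫ s in (0 : ℝ)..t, ρ s) with hr
  have hrd : ∀ t, HasDerivAt r (r t * ρ t) t := fun t =>
    (hρc.integral_hasStrictDerivAt 0 t).hasDerivAt.exp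
  have hmono : StrictMonoOn θ (Icc 0 1) := by
    refine strictMonoOn_of_deriv_pos (convex_Icc 0 1) hθc.continuousOn fun t ht => ?_
    rw [interior_Icc] at ht
    rw [(hθ t ⟨by linarith [ht.1], by linarith [ht.2]⟩).deriv]
    have := abs_le.1 (abs_pruferField_sub_pi_le hq hμ t (θ t))
    linarith [pi_gt_three]
  refine ⟨π ^ 2 + μ, fun t => r t * sin (θ t), fun t => r t * (π * cos (θ t)), ?_, ?_, ?_, ?_, ?_,
    ?_⟩
  · nlinarith [pi_gt_three, hμ.1]
  · intro t ht
    refine ((hrd t).mul (hθ t ht).sin).congr_deriv ?_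
    simp only [hρ, pruferField]
    ring
  · intro t ht
    refine ((hrd t).mul ((hθ t ht).cos.const_mul π)).congr_deriv ?_
    have hπ : (μ - q t) / π * π = μ - q t := div_mul_cancel₀ _ pi_ne_zero
    simp only [hρ, pruferField]
    linear_combination (-(r t) * sin (θ t)) * hπ -
      r t * sin (θ t) * ((μ - q t) / π * π) * sin_sq_add_cos_sq (θ t)
  · simp [hθ0]
  · simp [hθ1]
  · intro t ht
    have ht' := Ioo_subset_Icc_self ht
    have h1 := hmono (by norm_num : (0 : ℝ) ∈ Icc (0 : ℝ) 1) ht' ht.1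
    have h2 := hmono ht' (by norm_num : (1 : ℝ) ∈ Icc (0 : ℝ) 1) ht.2
    rw [hθ0] at h1
    rw [hθ1] at h2
    exact mul_pos (exp_pos _) (sin_pos_of_pos_of_lt_pi h1 h2)

end GroundState

/-! ### Minimality of the ground state eigenvalue and its dependence on the potential. -/

section Comparison

open Set MeasureTheory

lemma mem_Ioo_of_mem_Icc {t : ℝ} (ht : t ∈ Icc (0 : ℝ) 1) : t ∈ Ioo (-1 : ℝ) 2 :=
  ⟨by linarith [ht.1], by linarith [ht.2]⟩

namespace IsGroundState

variable {q u u' : ℝ → ℝ} {l : ℝ}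

lemma continuousOn (h : IsGroundState q l u u') : ContinuousOn u (Icc 0 1) := fun t ht =>
  (h.hasDerivAt t (mem_Ioo_of_mem_Icc ht)).continuousAt.continuousWithinAt

lemma continuousOn' (h : IsGroundState q l u u') : ContinuousOn u' (Icc 0 1) := fun t ht =>
  (h.hasDerivAt' t (mem_Ioo_of_mem_Icc ht)).continuousAt.continuousWithinAt

lemma nonneg (h : IsGroundState q l u u') {t : ℝ} (ht : t ∈ Icc (0 : ℝ) 1) : 0 ≤ u t := by
  rcases eq_or_lt_of_le ht.1 with h0 | h0
  · rw [← h0, h.zero]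
  rcases eq_or_lt_of_le ht.2 with h1 | h1
  · rw [h1, h.one]
  exact (h.pos t ⟨h0, h1⟩).le

lemma deriv_eventuallyEq (h : IsGroundState q l u u') {t : ℝ} (ht : t ∈ Ioo (-1 : ℝ) 2) :
    deriv u =ᶠ[nhds t] u' := by
  filter_upwards [isOpen_Ioo.mem_nhds ht] with s hs using (h.hasDerivAt s hs).deriv

lemma hasDerivAt_deriv (h : IsGroundState q l u u') {t : ℝ} (ht : t ∈ Ioo (-1 : ℝ) 2) :
    HasDerivAt (deriv u) ((q t - l) * u t) t :=
  (h.hasDerivAt' t ht).congr_of_eventuallyEq (h.deriv_eventuallyEq ht)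

lemma isEigenvalue (h : IsGroundState q l u u') (hq : Continuous q) : IsEigenvalue q l := by
  have hu : ContinuousOn u (Ioo (-1) 2) := fun t ht =>
    (h.hasDerivAt t ht).continuousAt.continuousWithinAt
  have hC2 : ContDiffOn ℝ 2 u (Ioo (-1) 2) := by
    rw [show (2 : WithTop ℕ∞) = 1 + 1 by norm_num, contDiffOn_succ_iff_deriv_of_isOpen isOpen_Ioo]
    refine ⟨fun t ht => (h.hasDerivAt t ht).differentiableAt.differentiableWithinAt, by simp, ?_⟩
    rw [show (1 : WithTop ℕ∞) = 0 + 1 by norm_num, contDiffOn_succ_iff_deriv_of_isOpen isOpen_Ioo]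
    refine ⟨fun t ht => (h.hasDerivAt_deriv ht).differentiableAt.differentiableWithinAt, by simp,
      ?_⟩
    rw [contDiffOn_zero]
    refine ContinuousOn.congr (f := fun t => (q t - l) * u t) ?_
      fun t ht => (h.hasDerivAt_deriv ht).deriv
    fun_prop
  refine ⟨u, hC2.mono fun t ht => mem_Ioo_of_mem_Icc ht,
    ⟨1 / 2, by norm_num, (h.pos _ (by norm_num)).ne'⟩, h.zero, h.one, fun t ht => ?_⟩
  rw [iteratedDeriv_succ, iteratedDeriv_one,
    (h.hasDerivAt_deriv (mem_Ioo_of_mem_Icc (Ioo_subset_Icc_self ht))).deriv]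
  ring

/-- Here `q ≤ 1 < l` and `u ≥ 0`, so `u'' = (q - l) u ≤ 0`. -/
lemma concaveOn (h : IsGroundState q l u u') (hq : ∀ t, q t ∈ Icc (0 : ℝ) 1) :
    ConcaveOn ℝ (Icc 0 1) u := by
  refine concaveOn_of_deriv2_nonpos' (convex_Icc 0 1)
    (fun t ht => (h.hasDerivAt t (mem_Ioo_of_mem_Icc ht)).differentiableAt.differentiableWithinAt)
    (fun t ht =>
      (h.hasDerivAt_deriv (mem_Ioo_of_mem_Icc ht)).differentiableAt.differentiableWithinAt)
    fun t ht => ?_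
  rw [Function.iterate_succ_apply, Function.iterate_one,
    (h.hasDerivAt_deriv (mem_Ioo_of_mem_Icc ht)).deriv]
  exact mul_nonpos_of_nonpos_of_nonneg (by linarith [(hq t).2, h.one_lt]) (h.nonneg ht)

/-- A ground state is comparable to its maximum in the middle half of the interval. -/
lemma le_four_mul (h : IsGroundState q l u u') (hq : ∀ t, q t ∈ Icc (0 : ℝ) 1) {x z : ℝ}
    (hx : x ∈ Icc (1 / 4 : ℝ) (3 / 4)) (hz : z ∈ Icc (0 : ℝ) 1) : u z ≤ 4 * u x := by
  -- `x` is a convex combination of `z` and the endpoint beyond `x`, where `u` vanishes. The weight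
  -- of `z` is at least `1/4`.
  have hc := h.concaveOn hq
  have huz := h.nonneg hz
  rcases lt_or_ge z x with hzx | hzx
  · have h1 : 0 < 1 - z := by linarith [hx.2]
    have := hc.2 hz (by norm_num : (1 : ℝ) ∈ Icc (0 : ℝ) 1) 
      (show 0 ≤ (1 - x) / (1 - z) from div_nonneg (by linarith [hx.2]) h1.le)
      (show 0 ≤ (x - z) / (1 - z) from div_nonneg (by linarith) h1.le) (by field_simp; ring)
    simp only [smul_eq_mul, h.one, mul_zero, add_zero] at this
    rw [show (1 - x) / (1 - z) * z + (x - z) / (1 - z) * 1 = x by field_simp; ring] at this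
    have h2 : 1 / 4 ≤ (1 - x) / (1 - z) := by
      rw [le_div_iff₀ h1]
      linarith [hx.2, hz.1]
    nlinarith
  · have h1 : 0 < z := by linarith [hx.1]
    have := hc.2 hz (by norm_num : (0 : ℝ) ∈ Icc (0 : ℝ) 1) 
      (show 0 ≤ x / z from div_nonneg (by linarith [hx.1]) h1.le)
      (show 0 ≤ (z - x) / z from div_nonneg (by linarith) h1.le) (by field_simp; ring)
    simp only [smul_eq_mul, h.zero, mul_zero, add_zero] at this
    rw [show x / z * z = x by field_simp] at this
    have h2 : 1 / 4 ≤ x / z := by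
      rw [le_div_iff₀ h1]
      linarith [hx.1, hz.2]
    nlinarith

/-- A solution with a smaller spectral parameter that vanishes at `0` and `1` is nowhere positive. -/
lemma solution_nonpos_of_lt (h : IsGroundState q l u u') {k : ℝ} (hk : k < l) {w w' : ℝ → ℝ}
    (hw : ∀ t ∈ Icc (0 : ℝ) 1, HasDerivWithinAt w (w' t) (Icc 0 1) t)
    (hwc' : ContinuousOn w' (Icc 0 1))
    (hw' : ∀ t ∈ Ioo (0 : ℝ) 1, HasDerivAt w' ((q t - k) * w t) t)
    (h0 : w 0 = 0) (h1 : w 1 = 0) {c : ℝ} (hc : c ∈ Icc (0 : ℝ) 1) : w c ≤ 0 := by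
  by_contra! hpos
  have hwc : ContinuousOn w (Icc 0 1) := fun t ht => (hw t ht).continuousWithinAt
  have hcompact : ∀ {s : Set ℝ}, s ⊆ Icc 0 1 → IsClosed s → IsCompact (s ∩ w ⁻¹' Iic 0) :=
    fun {s} hs hcl => (isCompact_Icc.of_isClosed_subset hcl hs).of_isClosed_subset
      ((hwc.mono hs).preimage_isClosed_of_isClosed hcl isClosed_Iic) inter_subset_left
  -- `(a, b)` is to be the largest interval around `c` on which `w > 0`.
  obtain ⟨a, ⟨ha, hwa⟩, hamax⟩ :=
    (hcompact (Icc_subset_Icc_right hc.2) isClosed_Icc).exists_isGreatest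
    ⟨0, ⟨le_rfl, hc.1⟩, h0.le⟩
  obtain ⟨b, ⟨hb, hwb⟩, hbmin⟩ := (hcompact (Icc_subset_Icc_left hc.1) isClosed_Icc).exists_isLeast
    ⟨1, ⟨hc.2, le_rfl⟩, h1.le⟩
  have hac : a < c := lt_of_le_of_ne ha.2 fun e => by
    rw [e] at hwa
    exact absurd hwa (not_le.2 hpos)
  have hcb : c < b := lt_of_le_of_ne hb.1 fun e => by
    rw [← e] at hwb
    exact absurd hwb (not_le.2 hpos)
  have hab : a < b := hac.trans hcb
  have hsub : Icc a b ⊆ Icc 0 1 := Icc_subset_Icc ha.1 hb.2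
  have hsub' : Ioo a b ⊆ Ioo 0 1 := Ioo_subset_Ioo ha.1 hb.2
  have hwpos : ∀ t ∈ Ioo a b, 0 < w t := by
    intro t ht
    by_contra! hneg
    rcases le_total t c with htc | htc
    · exact absurd (hamax ⟨⟨ha.1.trans ht.1.le, htc⟩, hneg⟩) (not_le.2 ht.1)
    · exact absurd (hbmin ⟨⟨htc, ht.2.le.trans hb.2⟩, hneg⟩) (not_le.2 ht.2)
  have hwnn : ∀ t ∈ Icc a b, 0 ≤ w t := by
    have hcl : closure (Ioo a b) = Icc a b := closure_Ioo hab.ne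
    intro t ht
    exact le_on_closure (fun s hs => (hwpos s hs).le) continuousOn_const
      (by rw [hcl]; exact hwc.mono hsub) (by rwa [hcl])
  have ma : a ∈ Icc a b := left_mem_Icc.2 hab.le
  have mb : b ∈ Icc a b := right_mem_Icc.2 hab.le
  have hwa0 : w a = 0 := le_antisymm hwa (hwnn a ma)
  have hwb0 : w b = 0 := le_antisymm hwb (hwnn b mb)
  have hsubI : Ioo a b ⊆ Icc 0 1 := Ioo_subset_Icc_self.trans hsub
  have hda : 0 ≤ w' a := by
    have ht := (hasDerivWithinAt_iff_tendsto_slope' (by simp)).1 ((hw a (hsub ma)).mono hsubI)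
    have := left_nhdsWithin_Ioo_neBot hab
    refine ge_of_tendsto ht ?_
    filter_upwards [self_mem_nhdsWithin] with s hs
    rw [slope_def_field, hwa0, sub_zero]
    exact div_nonneg (hwpos s hs).le (by linarith [hs.1])
  have hdb : w' b ≤ 0 := by
    have ht := (hasDerivWithinAt_iff_tendsto_slope' (by simp)).1 ((hw b (hsub mb)).mono hsubI)
    have := right_nhdsWithin_Ioo_neBot hab
    refine le_of_tendsto ht ?_
    filter_upwards [self_mem_nhdsWithin] with s hs
    rw [slope_def_field, hwb0, sub_zero]
    exact div_nonpos_of_nonneg_of_nonpos (hwpos s hs).le (by linarith [hs.2])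
  -- The Wronskian has derivative `(k - l) u w < 0`. At the ends it equals `-u w'`, which is `≤ 0`
  -- at `a` and `≥ 0` at `b`: a contradiction.
  have hanti : StrictAntiOn (fun t => u' t * w t - u t * w' t) (Icc a b) := by
    refine strictAntiOn_of_deriv_neg (convex_Icc a b) ?_ fun t ht => ?_
    · exact ((h.continuousOn'.mono hsub).mul (hwc.mono hsub)).sub
        ((h.continuousOn.mono hsub).mul (hwc'.mono hsub))
    · rw [interior_Icc] at ht
      have hI := hsub' ht
      have hm := mem_Ioo_of_mem_Icc (Ioo_subset_Icc_self hI)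
      have hwt : HasDerivAt w (w' t) t :=
        (hw t (Ioo_subset_Icc_self hI)).hasDerivAt (Icc_mem_nhds hI.1 hI.2)
      have hW : HasDerivAt (fun t => u' t * w t - u t * w' t) ((k - l) * (u t * w t)) t :=
        (((h.hasDerivAt' t hm).mul hwt).sub ((h.hasDerivAt t hm).mul (hw' t hI))).congr_deriv
          (by ring)
      rw [hW.deriv]
      nlinarith [mul_pos (mul_pos (h.pos t hI) (hwpos t ht)) (sub_pos.2 hk)]
  have hlt := hanti ma mb hab
  simp only [hwa0, hwb0, mul_zero, zero_sub] at hlt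
  nlinarith [mul_nonneg (h.nonneg (hsub ma)) hda, mul_nonneg (h.nonneg (hsub mb)) (neg_nonneg.2 hdb)]

/-- If `k < l`, then `solution_nonpos_of_lt` applies to an eigenfunction and to its negative, so the
eigenfunction vanishes identically. -/
lemma le_of_isEigenvalue (h : IsGroundState q l u u') {k : ℝ} (hk : IsEigenvalue q k) : l ≤ k := by
  by_contra! hlt
  obtain ⟨w, hw2, ⟨c, hc, hwc⟩, h0, h1, hode⟩ := hk
  have hU : UniqueDiffOn ℝ (Icc (0 : ℝ) 1) := uniqueDiffOn_Icc one_pos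
  have hd1 : ContDiffOn ℝ 1 (derivWithin w (Icc 0 1)) (Icc 0 1) :=
    ((contDiffOn_succ_iff_derivWithin hU).1
      (by rw [show (1 : WithTop ℕ∞) + 1 = 2 by norm_num]; exact hw2)).2.2
  have hd : ∀ t ∈ Icc (0 : ℝ) 1,
      HasDerivWithinAt w (derivWithin w (Icc 0 1) t) (Icc 0 1) t := fun t ht =>
    (hw2.differentiableOn (by norm_num) t ht).hasDerivWithinAt
  have hd' : ∀ t ∈ Ioo (0 : ℝ) 1,
      HasDerivAt (derivWithin w (Icc 0 1)) ((q t - k) * w t) t := by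
    intro t ht
    have hdiff := ((hd1.differentiableOn (by norm_num) t
      (Ioo_subset_Icc_self ht)).differentiableAt (Icc_mem_nhds ht.1 ht.2)).hasDerivAt
    refine hdiff.congr_deriv ?_
    have heq : derivWithin w (Icc 0 1) =ᶠ[nhds t] deriv w := by
      filter_upwards [isOpen_Ioo.mem_nhds ht] with s hs
        using derivWithin_of_mem_nhds (Icc_mem_nhds hs.1 hs.2)
    rw [heq.deriv_eq]
    have := hode t ht
    rw [iteratedDeriv_succ, iteratedDeriv_one] at this
    linarith
  have hle := h.solution_nonpos_of_lt hlt hd hd1.continuousOn hd' h0 h1 hc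
  have hge := h.solution_nonpos_of_lt hlt (w := -w) (w' := -derivWithin w (Icc 0 1))
    (fun t ht => (hd t ht).neg) hd1.continuousOn.neg
    (fun t ht => ((hd' t ht).neg).congr_deriv (by simp)) (by simp [h0]) (by simp [h1]) hc
  exact hwc (le_antisymm hle (by simpa using hge))

lemma smallestEigenvalue_eq (h : IsGroundState q l u u') (hq : Continuous q) :
    smallestEigenvalue q = l :=
  IsLeast.csInf_eq ⟨h.isEigenvalue hq, fun _ hk => h.le_of_isEigenvalue hk⟩

end IsGroundState

/-- Raising the potential in the middle half of the interval raises the smallest eigenvalue by at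
least a fixed fraction of the integral of the perturbation. -/
lemma integral_le_smallestEigenvalue_sub {p q : ℝ → ℝ} (hpc : Continuous p) (hqc : Continuous q)
    (hp : ∀ t, p t ∈ Icc (0 : ℝ) 1) (hq : ∀ t, q t ∈ Icc (0 : ℝ) 1) (hpq : ∀ t, p t ≤ q t)
    (hout : ∀ t, t ∉ Icc (1 / 4 : ℝ) (3 / 4) → p t = q t) :
    (1 / 16) * ∫ t in (0 : ℝ)..1, (q t - p t) ≤ smallestEigenvalue q - smallestEigenvalue p := by
  obtain ⟨l, u, u', hu⟩ := exists_isGroundState hpc hp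
  obtain ⟨k, v, v', hv⟩ := exists_isGroundState hqc hq
  rw [hu.smallestEigenvalue_eq hpc, hv.smallestEigenvalue_eq hqc]
  have huv : ContinuousOn (fun t => u t * v t) (Icc 0 1) := hu.continuousOn.mul hv.continuousOn
  have hint : ∀ {f : ℝ → ℝ}, ContinuousOn f (Icc 0 1) → IntervalIntegrable f volume 0 1 :=
    fun hf => hf.intervalIntegrable_of_Icc zero_le_one
  have hqpuv : ContinuousOn (fun t => (q t - p t) * (u t * v t)) (Icc 0 1) :=
    (hqc.sub hpc).continuousOn.mul huv
  have hkluv : ContinuousOn (fun t => (k - l) * (u t * v t)) (Icc 0 1) :=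
    continuousOn_const.mul huv
  have hwronsk : (k - l) * (∫ t in (0 : ℝ)..1, u t * v t) =
      ∫ t in (0 : ℝ)..1, (q t - p t) * (u t * v t) := by
    have hftc := intervalIntegral.integral_eq_sub_of_hasDerivAt
      (f := fun t => u t * v' t - u' t * v t) (a := 0) (b := 1)
      (f' := fun t => (q t - p t) * (u t * v t) - (k - l) * (u t * v t))
      (fun t ht => by
        rw [uIcc_of_le zero_le_one] at ht
        have hm := mem_Ioo_of_mem_Icc ht
        refine (((hu.hasDerivAt t hm).mul (hv.hasDerivAt' t hm)).sub
          ((hu.hasDerivAt' t hm).mul (hv.hasDerivAt t hm))).congr_deriv ?_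
        ring)
      (hint (hqpuv.sub hkluv))
    rw [intervalIntegral.integral_sub (hint hqpuv) (hint hkluv),
      intervalIntegral.integral_const_mul, hu.zero, hu.one, hv.zero, hv.one] at hftc
    linarith
  obtain ⟨z, hz, hzmax⟩ := isCompact_Icc.exists_isMaxOn
    (nonempty_Icc.2 (zero_le_one (α := ℝ))) huv
  -- Comparison with the maximum of `u v` removes the normalisation: `∫ u v ≤ M`, while `u v ≥ M /
  -- 16` on the middle half.
  set M := u z * v z with hM
  have hMpos : 0 < M := by
    have : u (1 / 2) * v (1 / 2) ≤ M := hzmax (by norm_num : (1 / 2 : ℝ) ∈ Icc (0 : ℝ) 1)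
    have h1 := hu.pos (1 / 2) (by norm_num)
    have h2 := hv.pos (1 / 2) (by norm_num)
    linarith [mul_pos h1 h2]
  have hIpos : 0 < ∫ t in (0 : ℝ)..1, u t * v t :=
    intervalIntegral.intervalIntegral_pos_of_pos_on (hint huv)
      (fun t ht => mul_pos (hu.pos t ht) (hv.pos t ht)) zero_lt_one
  have hIle : ∫ t in (0 : ℝ)..1, u t * v t ≤ M := by
    have := intervalIntegral.integral_mono_on (zero_le_one (α := ℝ)) (hint huv)
      (hint (continuousOn_const (c := M))) fun t ht => hzmax ht
    simpa using this
  have hlow : M / 16 * (∫ t in (0 : ℝ)..1, (q t - p t)) ≤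
      ∫ t in (0 : ℝ)..1, (q t - p t) * (u t * v t) := by
    rw [← intervalIntegral.integral_const_mul]
    refine intervalIntegral.integral_mono_on zero_le_one
      (hint (continuousOn_const.mul (hqc.sub hpc).continuousOn)) (hint hqpuv) fun t ht => ?_
    by_cases hmid : t ∈ Icc (1 / 4 : ℝ) (3 / 4)
    · have h1 := hu.le_four_mul hp hmid hz
      have h2 := hv.le_four_mul hq hmid hz
      have h3 : M ≤ 4 * u t * (4 * v t) :=
        mul_le_mul h1 h2 (hv.nonneg hz) (by linarith [hu.nonneg ht])
      nlinarith [sub_nonneg.2 (hpq t)]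
    · simp [hout t hmid]
  have hSnn : 0 ≤ ∫ t in (0 : ℝ)..1, (q t - p t) :=
    intervalIntegral.integral_nonneg zero_le_one fun t _ => sub_nonneg.2 (hpq t)
  rw [← hwronsk] at hlow
  have hkl : 0 ≤ k - l := by
    by_contra! hneg
    nlinarith [mul_pos (neg_pos.2 hneg) hIpos, mul_nonneg hMpos.le hSnn]
  have : M * ((1 / 16) * ∫ t in (0 : ℝ)..1, (q t - p t)) ≤ M * (k - l) := by
    nlinarith [mul_le_mul_of_nonneg_left hIle hkl]
  exact le_of_mul_le_mul_left this hMpos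

end Comparison

/-! ### The hypercube of bump potentials. -/

section Bumps

open Set MeasureTheory

/-- A nonnegative `C²` function supported in `(0,1)` and bounded by `1` together with its first
two derivatives. -/
structure IsUnitBump (φ : ℝ → ℝ) : Prop where
  contDiff : ContDiff ℝ 2 φ
  nonneg : ∀ s, 0 ≤ φ s
  abs_le : ∀ k : ℕ, k ≤ 2 → ∀ s, |iteratedDeriv k φ s| ≤ 1
  eq_zero : ∀ k : ℕ, ∀ s, s ∉ Ioo (0 : ℝ) 1 → iteratedDeriv k φ s = 0
  integral_pos : 0 < ∫ s in (0 : ℝ)..1, φ s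

lemma exists_isUnitBump : ∃ φ, IsUnitBump φ := by
  let f : ContDiffBump (1 / 2 : ℝ) := ⟨1 / 8, 1 / 4, by norm_num, by norm_num⟩
  have hf : ContDiff ℝ 2 f := f.contDiff
  have hzero : ∀ (k : ℕ) (s : ℝ), s ∉ Ioo (0 : ℝ) 1 → iteratedDeriv k f s = 0 := by
    intro k s hs
    have hmem : s ∈ (tsupport f)ᶜ := by
      rw [f.tsupport_eq, mem_compl_iff, Real.closedBall_eq_Icc]
      intro h
      have hr : f.rOut = 1 / 4 := rfl
      rw [hr] at h
      exact hs ⟨by linarith [h.1], by linarith [h.2]⟩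
    have hev : (f : ℝ → ℝ) =ᶠ[nhds s] fun _ => 0 := by
      filter_upwards [(isClosed_tsupport f).isOpen_compl.mem_nhds hmem] with t ht
        using image_eq_zero_of_notMem_tsupport ht
    rw [hev.iteratedDeriv_eq k, iteratedDeriv_const]
    simp
  have hbound : ∀ k : ℕ, k ≤ 2 → ∃ C, ∀ s, |iteratedDeriv k f s| ≤ C := by
    intro k hk
    obtain ⟨C, hC⟩ := isCompact_Icc.exists_bound_of_continuousOn (s := Icc (0 : ℝ) 1)
      (hf.continuous_iteratedDeriv k (by exact_mod_cast hk)).continuousOn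
    refine ⟨max C 0, fun s => ?_⟩
    by_cases hs : s ∈ Ioo (0 : ℝ) 1
    · exact (hC s (Ioo_subset_Icc_self hs)).trans (le_max_left _ _)
    · rw [hzero k s hs, abs_zero]
      exact le_max_right _ _
  choose! C hC using hbound
  -- Dividing by `D` normalises `f` and its first two derivatives simultaneously.
  set D := 1 + |C 0| + |C 1| + |C 2| with hD
  have hDpos : 0 < D := by positivity
  have hCD : ∀ k : ℕ, k ≤ 2 → C k ≤ D := by
    intro k hk
    have := le_abs_self (C k)
    interval_cases k <;> linarith [abs_nonneg (C 0), abs_nonneg (C 1), abs_nonneg (C 2)]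
  have hderiv : ∀ k : ℕ, k ≤ 2 → ∀ s,
      iteratedDeriv k (fun s => D⁻¹ * f s) s = D⁻¹ * iteratedDeriv k f s := fun k hk s =>
    iteratedDeriv_const_mul D⁻¹ f.contDiffAt
  refine ⟨fun s => D⁻¹ * f s, contDiff_const.mul hf,
    fun s => mul_nonneg (inv_nonneg.2 hDpos.le) f.nonneg, fun k hk s => ?_, fun k s hs => ?_, ?_⟩
  · rw [hderiv k hk, abs_mul, abs_of_pos (inv_pos.2 hDpos), inv_mul_le_iff₀ hDpos, mul_one]
    exact (hC k hk s).trans (hCD k hk)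
  · rw [iteratedDeriv_const_mul D⁻¹ f.contDiffAt, hzero k s hs, mul_zero]
  · rw [intervalIntegral.integral_const_mul]
    refine mul_pos (inv_pos.2 hDpos) ?_
    refine intervalIntegral.integral_pos zero_lt_one f.continuous.continuousOn
      (fun s _ => f.nonneg) ⟨1 / 2, by norm_num, f.pos_of_mem_ball ?_⟩
    exact Metric.mem_ball_self f.rOut_pos

/-- The potential obtained by putting a copy of the bump `φ`, of width `1/(2n)` and height of
order `n⁻²`, into the `i`-th of `n` cells of the interval `[1/4,3/4]` for each `i` with
`x i = 1`. -/
noncomputable def bumpPotential (φ : ℝ → ℝ) (n : ℕ) (x : Fin n → ZMod 2) (t : ℝ) : ℝ :=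
  (4 * (n : ℝ) ^ 2)⁻¹ *
    ∑ i : Fin n, (if x i = 1 then 1 else 0) * φ (2 * n * t - (n / 2 + (i : ℕ)))

/-- The points of the `i`-th of `n` cells of `[1/4,3/4]`. -/
def cell (n : ℕ) (i : Fin n) : Set ℝ := {t | 2 * n * t - (n / 2 + (i : ℕ)) ∈ Ioo (0 : ℝ) 1}

lemma disjoint_cell (n : ℕ) : Pairwise fun i j => Disjoint (cell n i) (cell n j) := by
  intro i j hij
  rw [Set.disjoint_left]
  rintro t ⟨hi0, hi1⟩ ⟨hj0, hj1⟩
  refine hij (Fin.ext ?_)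
  have h1 : ((i : ℕ) : ℝ) < (j : ℕ) + 1 := by linarith
  have h2 : ((j : ℕ) : ℝ) < (i : ℕ) + 1 := by linarith
  have h1' : (i : ℕ) < j + 1 := by exact_mod_cast h1
  have h2' : (j : ℕ) < i + 1 := by exact_mod_cast h2
  omega

lemma cell_subset {n : ℕ} (hn : 0 < n) (i : Fin n) : cell n i ⊆ Icc (1 / 4 : ℝ) (3 / 4) := by
  rintro t ⟨h0, h1⟩
  have hn' : (0 : ℝ) < n := by exact_mod_cast hn
  have hi : ((i : ℕ) : ℝ) + 1 ≤ n := by exact_mod_cast i.2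
  have hi0 : (0 : ℝ) ≤ (i : ℕ) := by positivity
  constructor <;> by_contra! h
  · nlinarith
  · nlinarith

namespace IsUnitBump

variable {φ : ℝ → ℝ}

lemma apply_eq_zero (hφ : IsUnitBump φ) {s : ℝ} (hs : s ∉ Ioo (0 : ℝ) 1) : φ s = 0 := by
  simpa using hφ.eq_zero 0 s hs

lemma iteratedDeriv_bumpPotential (hφ : IsUnitBump φ) {n : ℕ} (x : Fin n → ZMod 2) {k : ℕ}
    (hk : k ≤ 2) (t : ℝ) :
    iteratedDeriv k (bumpPotential φ n x) t = (4 * (n : ℝ) ^ 2)⁻¹ * (2 * n) ^ k *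
      ∑ i : Fin n, (if x i = 1 then 1 else 0) *
        iteratedDeriv k φ (2 * n * t - (n / 2 + (i : ℕ))) := by
  have hk' : (k : WithTop ℕ∞) ≤ 2 := by exact_mod_cast hk
  have hc : ContDiff ℝ k φ := hφ.contDiff.of_le hk'
  have hterm : ∀ i : Fin n, ContDiff ℝ k fun t : ℝ => φ (2 * n * t - (n / 2 + (i : ℕ))) :=
    fun i => hc.comp (by fun_prop)
  have hterm' : ∀ i : Fin n, ContDiff ℝ k fun t : ℝ =>
      (if x i = 1 then (1 : ℝ) else 0) * φ (2 * n * t - (n / 2 + (i : ℕ))) :=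
    fun i => contDiff_const.mul (hterm i)
  have hd : ∀ i : Fin n, iteratedDeriv k (fun t : ℝ => φ (2 * n * t - (n / 2 + (i : ℕ)))) t =
      (2 * n) ^ k * iteratedDeriv k φ (2 * n * t - (n / 2 + (i : ℕ))) := by
    intro i
    have hs : ContDiff ℝ k fun s : ℝ => φ (s - (n / 2 + (i : ℕ))) := hc.comp (by fun_prop)
    rw [iteratedDeriv_comp_const_mul hs (2 * (n : ℝ)), iteratedDeriv_comp_sub_const]
  unfold bumpPotential
  rw [iteratedDeriv_const_mul _ (ContDiff.sum fun i _ => hterm' i).contDiffAt,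
    iteratedDeriv_fun_sum fun i _ => (hterm' i).contDiffAt, mul_assoc]
  congr 1
  rw [Finset.mul_sum]
  refine Finset.sum_congr rfl fun i _ => ?_
  rw [iteratedDeriv_const_mul _ (hterm i).contDiffAt, hd i]
  ring

lemma contDiff_bumpPotential (hφ : IsUnitBump φ) {n : ℕ} (x : Fin n → ZMod 2) :
    ContDiff ℝ 2 (bumpPotential φ n x) :=
  contDiff_const.mul (ContDiff.sum fun i _ => contDiff_const.mul (hφ.contDiff.comp (by fun_prop)))

/-- At each point at most one summand is nonzero, and the scaling factor `(2n)^k / (4n²)` is at most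
`1` for `k ≤ 2`. Equality at `k = 2` dictates the height of the bumps. -/
lemma abs_iteratedDeriv_bumpPotential_le (hφ : IsUnitBump φ) {n : ℕ} (hn : 0 < n)
    (x : Fin n → ZMod 2) {k : ℕ} (hk : k ≤ 2) (t : ℝ) :
    |iteratedDeriv k (bumpPotential φ n x) t| ≤ 1 := by
  have hn1 : (1 : ℝ) ≤ n := by exact_mod_cast hn
  rw [hφ.iteratedDeriv_bumpPotential x hk, abs_mul]
  refine mul_le_one₀ ?_ (abs_nonneg _) ?_
  · rw [abs_of_nonneg (by positivity), inv_mul_le_iff₀ (by positivity), mul_one]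
    calc (2 * (n : ℝ)) ^ k ≤ (2 * n) ^ 2 := pow_le_pow_right₀ (by linarith) hk
      _ = 4 * (n : ℝ) ^ 2 := by ring
  · by_cases ht : ∃ i, t ∈ cell n i
    · obtain ⟨i, hi⟩ := ht
      rw [Finset.sum_eq_single i]
      · rw [abs_mul]
        refine mul_le_one₀ ?_ (abs_nonneg _) (hφ.abs_le k hk _)
        split_ifs <;> simp
      · intro j _ hj
        rw [hφ.eq_zero k _ fun h => Set.disjoint_left.1 (disjoint_cell n hj) h hi, mul_zero]
      · simp
    · push Not at ht
      rw [Finset.sum_eq_zero fun i _ => by rw [hφ.eq_zero k _ (ht i), mul_zero]]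
      simp

lemma bumpPotential_mem_Icc (hφ : IsUnitBump φ) {n : ℕ} (hn : 0 < n)
    (x : Fin n → ZMod 2) (t : ℝ) : bumpPotential φ n x t ∈ Icc (0 : ℝ) 1 := by
  have h := hφ.abs_iteratedDeriv_bumpPotential_le hn x (k := 0) (by norm_num) t
  rw [iteratedDeriv_zero] at h
  refine ⟨mul_nonneg (by positivity) (Finset.sum_nonneg fun i _ => mul_nonneg ?_ (hφ.nonneg _)),
    (le_abs_self _).trans h⟩
  split_ifs <;> norm_num

lemma bumpPotential_mem_potentialClass (hφ : IsUnitBump φ) {n : ℕ} (hn : 0 < n)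
    (x : Fin n → ZMod 2) : bumpPotential φ n x ∈ potentialClass := by
  refine ⟨(hφ.contDiff_bumpPotential x).contDiffOn,
    fun t _ => hφ.bumpPotential_mem_Icc hn x t, fun k hk t ht => ?_⟩
  rw [iteratedDerivWithin_eq_iteratedDeriv (uniqueDiffOn_Icc one_pos)
    ((hφ.contDiff_bumpPotential x).of_le (by exact_mod_cast hk)).contDiffAt ht]
  exact hφ.abs_iteratedDeriv_bumpPotential_le hn x hk t

lemma bumpPotential_eq_of_notMem_cell (hφ : IsUnitBump φ) {n : ℕ} (x : Fin n → ZMod 2)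
    (i : Fin n) (t : ℝ) (ht : t ∉ cell n i) :
    bumpPotential φ n x t = bumpPotential φ n (x + Pi.single i 1) t := by
  unfold bumpPotential
  congr 1
  refine Finset.sum_congr rfl fun j _ => ?_
  by_cases hj : j = i
  · subst hj
    rw [hφ.apply_eq_zero ht, mul_zero, mul_zero]
  · simp [Pi.single_eq_of_ne hj]

lemma bumpPotential_add_single_sub {n : ℕ} {x : Fin n → ZMod 2}
    {i : Fin n} (hx : x i = 0) (t : ℝ) :
    bumpPotential φ n (x + Pi.single i 1) t - bumpPotential φ n x t =
      (4 * (n : ℝ) ^ 2)⁻¹ * φ (2 * n * t - (n / 2 + (i : ℕ))) := by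
  unfold bumpPotential
  rw [← mul_sub, ← Finset.sum_sub_distrib, Finset.sum_eq_single i]
  · simp [hx]
  · intro j _ hj
    simp [Pi.single_eq_of_ne hj]
  · simp

/-- Adding one bump raises the smallest eigenvalue by at least a constant times `n⁻³`. -/
lemma le_smallestEigenvalue_sub (hφ : IsUnitBump φ) {n : ℕ} (hn : 0 < n) {x : Fin n → ZMod 2}
    {i : Fin n} (hx : x i = 0) :
    (∫ s in (0 : ℝ)..1, φ s) / 128 / (n : ℝ) ^ 3 ≤
      smallestEigenvalue (bumpPotential φ n (x + Pi.single i 1)) -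
        smallestEigenvalue (bumpPotential φ n x) := by
  have hn' : (0 : ℝ) < n := by exact_mod_cast hn
  have hi : ((i : ℕ) : ℝ) + 1 ≤ n := by exact_mod_cast i.2
  have hi0 : (0 : ℝ) ≤ (i : ℕ) := by positivity
  have h := integral_le_smallestEigenvalue_sub (hφ.contDiff_bumpPotential x).continuous
    (hφ.contDiff_bumpPotential (x + Pi.single i 1)).continuous (hφ.bumpPotential_mem_Icc hn x)
    (hφ.bumpPotential_mem_Icc hn _)
    (fun t => sub_nonneg.1 (by
      rw [bumpPotential_add_single_sub hx]
      exact mul_nonneg (by positivity) (hφ.nonneg _)))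
    (fun t ht => hφ.bumpPotential_eq_of_notMem_cell x i t fun hc => ht (cell_subset hn i hc))
  refine le_trans ?_ h
  simp_rw [bumpPotential_add_single_sub hx]
  rw [intervalIntegral.integral_const_mul,
    intervalIntegral.integral_comp_mul_sub φ (by positivity : (2 * (n : ℝ)) ≠ 0), smul_eq_mul]
  -- The substitution carries `[0,1]` to an interval containing the support of `φ`.
  have hmono : ∫ s in (0 : ℝ)..1, φ s ≤
      ∫ s in (2 * n * 0 - (n / 2 + (i : ℕ)) : ℝ)..(2 * n * 1 - (n / 2 + (i : ℕ))), φ s :=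
    intervalIntegral.integral_mono_interval (by linarith) zero_le_one (by linarith)
      (Filter.Eventually.of_forall hφ.nonneg) (hφ.contDiff.continuous.intervalIntegrable _ _)
  -- `128 = 16 * 4 * 2`: eigenvalue comparison, bump height, bump width.
  calc (∫ s in (0 : ℝ)..1, φ s) / 128 / (n : ℝ) ^ 3
      = 1 / 16 * ((4 * (n : ℝ) ^ 2)⁻¹ * ((2 * (n : ℝ))⁻¹ * ∫ s in (0 : ℝ)..1, φ s)) := by
        field_simp
        ring
    _ ≤ _ := by gcongr

lemma le_abs_smallestEigenvalue_sub (hφ : IsUnitBump φ) {n : ℕ} (hn : 0 < n)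
    (x : Fin n → ZMod 2) (i : Fin n) :
    (∫ s in (0 : ℝ)..1, φ s) / 128 / (n : ℝ) ^ 3 ≤
      |smallestEigenvalue (bumpPotential φ n x) -
        smallestEigenvalue (bumpPotential φ n (x + Pi.single i 1))| := by
  have hcases : ∀ a : ZMod 2, a = 0 ∨ a + 1 = 0 := by decide
  rcases hcases (x i) with hx | hx
  · rw [abs_sub_comm]
    exact (hφ.le_smallestEigenvalue_sub hn hx).trans (le_abs_self _)
  · have hy : (x + Pi.single i 1 : Fin n → ZMod 2) i = 0 := by simpa using hx
    have hxx : x + Pi.single i 1 + Pi.single i 1 = x := by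
      rw [add_assoc, ← Pi.single_add, show (1 : ZMod 2) + 1 = 0 by decide, Pi.single_zero,
        add_zero]
    have := hφ.le_smallestEigenvalue_sub hn hy
    rw [hxx] at this
    exact this.trans (le_abs_self _)

end IsUnitBump

/-- Query counts are integers, so the real bound passes through its ceiling to an infimum in `ℕ∞`.
-/
lemma le_bitQueryComplexity {ε r : ℝ}
    (h : ∀ A : BitQueryAlgorithm, A.ComputesApproximation ε → r ≤ A.T) :
    ENNReal.ofReal r ≤ ((bitQueryComplexity ε : ℕ∞) : ℝ≥0∞) := by
  have h1 : ((⌈r⌉₊ : ℕ) : ℕ∞) ≤ bitQueryComplexity ε := by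
    refine le_sInf ?_
    rintro _ ⟨A, hA, rfl⟩
    exact_mod_cast Nat.ceil_le.2 (h A hA)
  calc ENNReal.ofReal r ≤ ENNReal.ofReal (⌈r⌉₊ : ℝ) := ENNReal.ofReal_le_ofReal (Nat.le_ceil r)
    _ = (((⌈r⌉₊ : ℕ) : ℕ∞) : ℝ≥0∞) := by simp
    _ ≤ _ := by exact_mod_cast h1

end Bumps

end SturmLiouville

/-! ### Choice of the number of bumps. -/

theorem mainTheorem5 :
    ∃ c : ℝ, 0 < c ∧ ∃ ε₀ : ℝ, 0 < ε₀ ∧ ∀ ε : ℝ, 0 < ε → ε ≤ ε₀ →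
      ENNReal.ofReal (c * ε ^ (-(1 / 3) : ℝ)) ≤
        ((SturmLiouville.bitQueryComplexity ε : ℕ∞) : ℝ≥0∞) := by
  obtain ⟨φ, hφ⟩ := SturmLiouville.exists_isUnitBump
  set a : ℝ := (∫ s in (0 : ℝ)..1, φ s) / 128 with ha
  have hapos : 0 < a := div_pos hφ.integral_pos (by norm_num)
  -- With `n = ⌊R⌋₊` and `R ^ 3 = a / (4 ε)`, one has `2 ε n³ ≤ a / 2 < a`. The condition `ε ≤ a /
  -- 4` gives `R ≥ 1`, so `n ≥ R / 2`, and `n / 32` becomes `R / 64`.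
  refine ⟨(a / 4) ^ (1 / 3 : ℝ) / 64, by positivity, a / 4, by positivity, fun ε hε hε₀ => ?_⟩
  set R : ℝ := (a / 4) ^ (1 / 3 : ℝ) * ε ^ (-(1 / 3) : ℝ) with hR
  have hReq : R = (a / 4 / ε) ^ (1 / 3 : ℝ) := by
    rw [Real.div_rpow (by positivity) hε.le, hR, Real.rpow_neg hε.le, ← div_eq_mul_inv]
  have hR1 : 1 ≤ R := by
    rw [hReq]
    exact Real.one_le_rpow ((one_le_div hε).2 hε₀) (by norm_num)
  have hR3 : R ^ 3 = a / 4 / ε := by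
    rw [hReq, ← Real.rpow_natCast, ← Real.rpow_mul (by positivity)]
    norm_num
  set n := ⌊R⌋₊ with hn
  have hnpos : 0 < n := Nat.floor_pos.2 hR1
  have hn1 : (1 : ℝ) ≤ n := by exact_mod_cast hnpos
  have hnR : (n : ℝ) ≤ R := Nat.floor_le (by linarith)
  have hRn : R < n + 1 := Nat.lt_floor_add_one R
  have hgap : 2 * ε < a / (n : ℝ) ^ 3 := by
    have h3 : (n : ℝ) ^ 3 ≤ a / 4 / ε := hR3 ▸ pow_le_pow_left₀ (by linarith) hnR 3
    rw [le_div_iff₀ hε] at h3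
    rw [lt_div_iff₀ (by positivity)]
    nlinarith
  refine SturmLiouville.le_bitQueryComplexity fun A hA => ?_
  have hT := A.le_T_of_hypercube hA (SturmLiouville.bumpPotential φ n)
    (SturmLiouville.cell n) (SturmLiouville.disjoint_cell n)
    hφ.bumpPotential_eq_of_notMem_cell (hφ.bumpPotential_mem_potentialClass hnpos)
    fun x i => hgap.trans_le (hφ.le_abs_smallestEigenvalue_sub hnpos x i)
  calc (a / 4) ^ (1 / 3 : ℝ) / 64 * ε ^ (-(1 / 3) : ℝ) = R / 64 := by rw [hR]; ring
    _ ≤ A.T := by linarith
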